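/- Let $G$ be a finite tree with node set $\mathcal N$ and $L$ links, and let $r\in\mathbb R$. Consider the system $$\frac{dx_i}{dt}=\sum_{j\sim i}\bigl(r(x_i-x_j)-(x_i-x_j)^3\bigr),\qquad i\in\mathcal N,$$ on the state space $X=\mathbb R^{\mathcal N}/\mathbf 1$ of node states modulo a common additive constant, with potential $$V(x)=\tfrac14\sum_{i\sim j}(x_i-x_j)^2\bigl((x_i-x_j)^2-2r\bigr)$$ (sum over links) and critical potential $V_c=-(L-1)r^2/4$. A state $x^\star\in X$ is stationary if the right-hand side of the system vanishes at $x^\star$ for every node, and a stationary state is (linearly) stable if the Jacobian of the system at $x^\star$ is negative definite on $X$, i.e. $w^TJ(x^\star)w<0$ for every non-constant $w$. The basin of attraction $W(x^\star)\subseteq X$ is the set of initial states whose solution exists for all $t\ge 0$ and converges to $x^\star$ in $X$ as $t\to\infty$. Then the region $X|_{V<V_c}=\{x\in X: V(x)<V_c\}$ is partitioned by the basins of the stable stationary states only: it is the union of the sets $W(x^\star)\cap X|_{V<V_c}$ over stable $x^\star$, these sets are pairwise disjoint for distinct stable $x^\star$, and $W(x^\star)\cap X|_{V<V_c}=\emptyset$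 for every stationary $x^\star$ that is not stable. If $r>0$, the stable stationary states are exactly the full-dissensus states (those with $x^\star_i-x^\star_j\in\{\sqrt r,-\sqrt r\}$ for every link $i\sim j$), and $W(x^\star)\cap X|_{V<V_c}$ is non-empty for each of them. Furthermore, for every stationary state $x^\star$, $$W(x^\star)\cap X|_{V<V_c}=\{x\in X:\ (x_i-x_j)(x^\star_i-x^\star_j)>0\ \text{ for all } i\sim j\}\cap X|_{V<V_c}.$$ -/

import Mathlib

open Filter Topology

namespace PitchforkNetwork

noncomputable section

/-- The state space `ℝ^N / 𝟏`: node states up to a common additive constant, with its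
quotient topology. -/
abbrev StateSpace (N : Type*) : Type _ :=
  (N → ℝ) ⧸ Submodule.span ℝ {(1 : N → ℝ)}

/-- The class of a vector of node states in the state space. -/
def toState {N : Type*} (u : N → ℝ) : StateSpace N :=
  Submodule.Quotient.mk u

/-- The state difference `x_i - x_j`, which is well defined on the state space. -/
def diff {N : Type*} (i j : N) : StateSpace N →ₗ[ℝ] ℝ :=
  Submodule.liftQ (Submodule.span ℝ {(1 : N → ℝ)})
    (LinearMap.proj (R := ℝ) (φ := fun _ : N => ℝ) i - LinearMap.proj (φ := fun _ : N => ℝ) j)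
    (by
      rw [Submodule.span_singleton_le_iff_mem, LinearMap.mem_ker]
      simp)

@[simp]
theorem diff_toState {N : Type*} (i j : N) (u : N → ℝ) :
    diff i j (toState u) = u i - u j := by
  simp [diff, toState]

theorem diff_swap {N : Type*} (i j : N) (x : StateSpace N) :
    diff j i x = -diff i j x := by
  obtain ⟨u, rfl⟩ := Submodule.Quotient.mk_surjective _ x
  simp [diff]

variable {N : Type*} [Fintype N] [DecidableEq N] (G : SimpleGraph N) [DecidableRel G.Adj] (r : ℝ)

/-- The right-hand side `∑_{j ∼ i} r (x_i - x_j) - (x_i - x_j)³` of the system at node `i`. -/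
def velocity (x : StateSpace N) (i : N) : ℝ :=
  ∑ j ∈ G.neighborFinset i, (r * diff i j x - (diff i j x) ^ 3)

/-- `u : ℝ → ℝ^N` solves the system for all times `t ≥ 0` (its values at negative times are
irrelevant). -/
def IsSolution (u : ℝ → N → ℝ) : Prop :=
  ∀ t, 0 ≤ t → ∀ i, HasDerivWithinAt (fun s => u s i) (velocity G r (toState (u t)) i) (Set.Ici 0) t

/-- The potential `V(x) = ¼ ∑_{i ∼ j} (x_i - x_j)² ((x_i - x_j)² - 2r)`, the sum being over the
(unordered) links. -/
def potential (x : StateSpace N) : ℝ :=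
  (1 / 4) * ∑ e ∈ G.edgeFinset,
    Sym2.lift ⟨fun i j => (diff i j x) ^ 2 * ((diff i j x) ^ 2 - 2 * r), fun i j => by
      simp only [diff_swap i j x, neg_sq]⟩ e

/-- The critical potential `V_c = -(L - 1) r² / 4`, with `L` the number of links. -/
def criticalPotential : ℝ :=
  -((G.edgeFinset.card : ℝ) - 1) * r ^ 2 / 4

/-- The region of the state space with potential below the critical potential. -/
def subcritical : Set (StateSpace N) :=
  {x | potential G r x < criticalPotential G r}

/-- Stationary states: the right-hand side of the system vanishes at every node. -/
def IsStationaryState (x : StateSpace N) : Prop :=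
  ∀ i, velocity G r x i = 0

/-- The Jacobian of the system: the `(i, j)` entry is the partial derivative of the
right-hand side at node `i` with respect to the state of node `j`. -/
def jacobian (x : StateSpace N) : Matrix N N ℝ :=
  Matrix.of fun i j => deriv (fun s : ℝ => velocity G r (x + toState (Pi.single j s)) i) 0

/-- (Linearly) stable stationary states: the Jacobian is negative definite on the state space,
i.e. on perturbations that are nonzero modulo constants. -/
def IsStable (x : StateSpace N) : Prop :=
  IsStationaryState G r x ∧
    ∀ w : N → ℝ, toState w ≠ 0 → w ⬝ᵥ (jacobian G r x).mulVec w < 0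

/-- The basin of attraction of `xs`: the initial states whose solution exists for all `t ≥ 0` and
converges to `xs` in the state space as `t → ∞`. (Solutions are unique, the right-hand side being
polynomial.) -/
def basin (xs : StateSpace N) : Set (StateSpace N) :=
  {x₀ | ∃ u : ℝ → N → ℝ, IsSolution G r u ∧ toState (u 0) = x₀ ∧
    Tendsto (fun t => toState (u t)) atTop (𝓝 xs)}

/-- Full dissensus: every link difference is `√r` or `-√r`. -/
def IsFullDissensus (x : StateSpace N) : Prop :=
  ∀ i j, G.Adj i j → diff i j x = √r ∨ diff i j x = -√r

end

end PitchforkNetwork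

open PitchforkNetwork

set_option linter.unusedSectionVars false

/-! The system is the gradient flow of $V$, so $V$ decreases along solutions. Up to the factor 1/4,
a link with difference $y$ contributes $y^2(y^2-2r) = (y^2-r)^2 - r^2 \ge -r^2$. If one link
contributes at least 0, then $V \ge V_c$; hence below $V_c$ every link has $0 < y^2 < 2r$
(`le_four_mul_potential`). So no difference can change sign there (`IsSolution.diff_mul_pos`), and
solutions stay bounded and exist for all times (`exists_isSolution`).

On a tree, testing with the indicator of one side of a link isolates that link: stationarity means
$ry = y^3$ on each link, and stability for $r>0$ means $y^2 = r$ on each link. Every sign pattern is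
realised by exactly one full-dissensus state.

Below $V_c$ the solution converges to the full-dissensus state with its own signs, because the
squared distance decays exponentially (`IsSolution.tendsto_of_isFullDissensus`). Basins there are
thus sign classes. For $r \le 0$ the region is empty or the tree has no links. -/

namespace PitchforkNetwork

/-! ### Global existence for ODEs by cutoff -/

section GlobalSolutions

variable {E : Type*} [NormedAddCommGroup E] [NormedSpace ℝ E]

/-- A bounded Lipschitz vector field has solutions on every bounded time interval. -/
theorem exists_solution_Ioo_of_lipschitz [CompleteSpace E] {f : E → E} {K : NNReal}
    (hK : LipschitzWith K f) {C : ℝ} (hC : ∀ x, ‖f x‖ ≤ C) (x₀ : E) {T : ℝ} (hT : 0 < T) :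
    ∃ α : ℝ → E, α 0 = x₀ ∧ ∀ t ∈ Set.Ioo (-T) T, HasDerivAt α (f (α t)) t := by
  have h0 : (0 : ℝ) ∈ Set.Icc (-T) T := ⟨by linarith, hT.le⟩
  have hC0 : 0 ≤ C := (norm_nonneg _).trans (hC x₀)
  -- At speed at most `C` a solution travels at most `C * T` by time `T`, so this radius suffices.
  have hpl : IsPicardLindelof (fun _ ↦ f) (⟨0, h0⟩ : Set.Icc (-T) T) x₀
      (⟨C * T, by positivity⟩ : NNReal) 0 ⟨C, hC0⟩ K := by
    refine IsPicardLindelof.of_time_independent (fun x _ ↦ hC x) hK.lipschitzOnWith ?_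
    rw [sub_zero, zero_sub, neg_neg, max_self, NNReal.coe_zero, sub_zero]
    exact le_rfl
  obtain ⟨α, hα0, hα⟩ := hpl.exists_eq_forall_mem_Icc_hasDerivWithinAt₀
  exact ⟨α, hα0, fun t ht ↦ (hα t (Set.Ioo_subset_Icc_self ht)).hasDerivAt
    (Icc_mem_nhds ht.1 ht.2)⟩

/-- A bounded Lipschitz vector field has global solutions. -/
theorem exists_global_solution_of_lipschitz [CompleteSpace E] {f : E → E} {K : NNReal}
    (hK : LipschitzWith K f) {C : ℝ} (hC : ∀ x, ‖f x‖ ≤ C) (x₀ : E) :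
    ∃ α : ℝ → E, α 0 = x₀ ∧ ∀ t, HasDerivAt α (f (α t)) t := by
  have h := fun n : ℕ ↦ exists_solution_Ioo_of_lipschitz hK hC x₀ (T := (n : ℝ) + 1) (by positivity)
  choose α hα0 hα using h
  have key : ∀ m n : ℕ, m ≤ n → ∀ t ∈ Set.Ioo (-((m : ℝ) + 1)) ((m : ℝ) + 1), α m t = α n t := by
    intro m n hmn
    have hmn' : (m : ℝ) ≤ n := by exact_mod_cast hmn
    have hm : (0 : ℝ) ≤ m := by positivity
    exact ODE_solution_unique_of_mem_Ioo (v := fun _ ↦ f) (s := fun _ ↦ Set.univ) (t₀ := 0)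
      (fun _ _ ↦ hK.lipschitzOnWith) ⟨by linarith, by linarith⟩
      (fun t ht ↦ ⟨hα m t ht, trivial⟩)
      (fun t ht ↦ ⟨hα n t ⟨by linarith [ht.1], by linarith [ht.2]⟩, trivial⟩)
      (by rw [hα0, hα0])
  -- The half-length `n + 1` keeps `t` in the open interval even when `|t| = n`.
  have mem : ∀ t : ℝ, ∀ n : ℕ, ⌈|t|⌉₊ ≤ n → t ∈ Set.Ioo (-((n : ℝ) + 1)) ((n : ℝ) + 1) := by
    intro t n hn
    have := (Nat.le_ceil |t|).trans (Nat.cast_le.mpr hn)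
    have := abs_le.mp this
    constructor <;> linarith [this.1, this.2]
  refine ⟨fun t ↦ α ⌈|t|⌉₊ t, by simp [hα0], fun t ↦ ?_⟩
  have ht := mem t _ le_rfl
  have hev : (fun s ↦ α ⌈|s|⌉₊ s) =ᶠ[𝓝 t] α ⌈|t|⌉₊ := by
    filter_upwards [Ioo_mem_nhds ht.1 ht.2] with s hs
    rcases le_total ⌈|s|⌉₊ ⌈|t|⌉₊ with h | h
    · exact key _ _ h s (mem s _ le_rfl)
    · exact (key _ _ h s hs).symm
  exact (hα _ t ht).congr_of_eventuallyEq hev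

/-- A `C¹` vector field in finite dimension agrees on any closed ball about the origin with a
multiple of itself by a nonnegative factor that has global solutions. -/
theorem exists_cutoff_solution [FiniteDimensional ℝ E] {f : E → E} (hf : ContDiff ℝ 1 f)
    (x₀ : E) (R : ℝ) :
    ∃ (χ : E → ℝ) (α : ℝ → E), (∀ x, 0 ≤ χ x) ∧ (∀ x, ‖x‖ ≤ R → χ x = 1) ∧ α 0 = x₀ ∧
      ∀ t, HasDerivAt α (χ (α t) • f (α t)) t := by
  have hR : 0 < max R 1 := by positivity
  let b : ContDiffBump (0 : E) := ⟨max R 1, max R 1 + 1, hR, by linarith⟩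
  have hd : ContDiff ℝ 1 fun x ↦ b x • f x := b.contDiff.smul hf
  have hs : HasCompactSupport fun x ↦ b x • f x := b.hasCompactSupport.smul_right
  obtain ⟨K, hK⟩ := hd.lipschitzWith_of_hasCompactSupport hs one_ne_zero
  obtain ⟨C, hC⟩ := hs.exists_bound_of_continuous hd.continuous
  have := FiniteDimensional.complete ℝ E
  obtain ⟨α, h0, hα⟩ := exists_global_solution_of_lipschitz hK hC x₀
  refine ⟨b, α, fun x ↦ b.nonneg, fun x hx ↦ b.one_of_mem_closedBall ?_, h0, hα⟩
  rw [mem_closedBall_zero_iff]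
  exact hx.trans (le_max_left _ _)

end GlobalSolutions

/-! ### Cuts, summation by parts and inequalities on graphs -/

section Graph


variable {N : Type*} {G : SimpleGraph N}

/-- The indicator of the side of `a` in the graph with the edge `ab` removed. -/
noncomputable def cutIndicator (G : SimpleGraph N) (a b i : N) : ℝ :=
  open Classical in if (G.deleteEdges {s(a, b)}).Reachable a i then 1 else 0

theorem cutIndicator_eq_of_adj {a b i j : N} (hij : G.Adj i j) (h : s(i, j) ≠ s(a, b)) :
    cutIndicator G a b i = cutIndicator G a b j := by
  have hadj : (G.deleteEdges {s(a, b)}).Adj i j := by simp [hij, h]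
  have : (G.deleteEdges {s(a, b)}).Reachable a i ↔ (G.deleteEdges {s(a, b)}).Reachable a j :=
    ⟨fun h ↦ h.trans hadj.reachable, fun h ↦ h.trans hadj.reachable.symm⟩
  by_cases hj : (G.deleteEdges {s(a, b)}).Reachable a j
  · simp [cutIndicator, hj, this.mpr hj]
  · simp [cutIndicator, hj, mt this.mp hj]

theorem cutIndicator_left (a b : N) : cutIndicator G a b a = 1 := by
  simp [cutIndicator]

theorem cutIndicator_right (hG : G.IsAcyclic) {a b : N} (hab : G.Adj a b) :
    cutIndicator G a b b = 0 := by
  have := SimpleGraph.isBridge_iff.mp (SimpleGraph.isAcyclic_iff_forall_isBridge.mp hG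
    ((G.mem_edgeSet).mpr hab))
  simp [cutIndicator, this]

/-- Each edge of a forest is a bridge, so the indicator jumps across `ab` and no other link. -/
theorem cutIndicator_sub [DecidableEq N] (hG : G.IsAcyclic) {a b i j : N} (hab : G.Adj a b) (hij : G.Adj i j) :
    cutIndicator G a b i - cutIndicator G a b j =
      (if i = a ∧ j = b then 1 else 0) - (if i = b ∧ j = a then 1 else 0) := by
  have hne := hab.ne
  by_cases h : s(i, j) = s(a, b)
  · rcases Sym2.eq_iff.mp h with ⟨rfl, rfl⟩ | ⟨rfl, rfl⟩
    · simp [cutIndicator_left, cutIndicator_right hG hab, hne]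
    · simp [cutIndicator_left, cutIndicator_right hG hab, hne]
  · rw [cutIndicator_eq_of_adj hij h, sub_self]
    have h' := mt Sym2.eq_iff.mpr h
    push Not at h'
    rw [if_neg (by rintro ⟨rfl, rfl⟩; exact h rfl),
      if_neg (by rintro ⟨rfl, rfl⟩; exact h Sym2.eq_swap), sub_zero]

variable [Fintype N]

/-- In a connected graph, node differences are bounded by the number of nodes times a bound on the
link differences. -/
theorem abs_sub_le_card_mul (hG : G.Connected) {w : N → ℝ} {S : ℝ} (hS0 : 0 ≤ S)
    (hS : ∀ i j, G.Adj i j → |w i - w j| ≤ S) (i j : N) :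
    |w i - w j| ≤ Fintype.card N * S := by
  have hwalk : ∀ {i j : N} (p : G.Walk i j), |w i - w j| ≤ p.length * S := by
    intro i j p
    induction p with
    | nil => simp
    | @cons a b c hab q ih =>
      have := abs_sub_le (w a) (w b) (w c)
      have := hS a b hab
      rw [SimpleGraph.Walk.length_cons]; push_cast; linarith
  obtain ⟨p, hp⟩ := (hG.preconnected i j).exists_isPath
  refine (hwalk p).trans ?_
  have := hp.length_lt.le
  gcongr

/-- If the mean vanishes, node values are bounded by the largest node difference. -/
theorem abs_le_of_sum_eq_zero {w : N → ℝ} (hw : ∑ i, w i = 0) {B : ℝ}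
    (hB : ∀ i j, |w i - w j| ≤ B) (i : N) : |w i| ≤ B := by
  have hpos : (0 : ℝ) < Fintype.card N := by exact_mod_cast Fintype.card_pos_iff.mpr ⟨i⟩
  have h1 : ∑ j, (w i - w j) = Fintype.card N * w i := by
    simp [Finset.sum_sub_distrib, hw]
  have h2 : |∑ j, (w i - w j)| ≤ Fintype.card N * B :=
    (Finset.abs_sum_le_sum_abs _ _).trans ((Finset.sum_le_sum fun j _ ↦ hB i j).trans (by simp))
  rw [h1, abs_mul, abs_of_pos hpos] at h2
  exact le_of_mul_le_mul_left h2 hpos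

variable [DecidableRel G.Adj]

variable (G) in
-- Each edge carries two darts.
theorem sum_edgeFinset_eq_half_sum [DecidableEq N] (f : Sym2 N → ℝ) :
    ∑ e ∈ G.edgeFinset, f e = (1 / 2) * ∑ i, ∑ j ∈ G.neighborFinset i, f s(i, j) := by
  have h1 : ∑ d : G.Dart, f d.edge = ∑ e ∈ G.edgeFinset, 2 * f e := by
    rw [← Finset.sum_fiberwise_of_maps_to (s := Finset.univ) (t := G.edgeFinset)
      (g := fun d : G.Dart ↦ d.edge) (fun d _ ↦ by simp [d.edge_mem])]
    refine Finset.sum_congr rfl fun e he ↦ ?_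
    rw [Finset.sum_congr rfl (g := fun _ ↦ f e) (fun d hd ↦ by rw [(Finset.mem_filter.mp hd).2]),
      Finset.sum_const, G.dart_edge_fiber_card e (by simpa using he)]
    simp
  have h2 : ∑ d : G.Dart, f d.edge = ∑ i, ∑ j ∈ G.neighborFinset i, f s(i, j) := by
    rw [Finset.sum_sigma']
    refine Finset.sum_bij' (fun d _ ↦ ⟨d.fst, d.snd⟩)
      (fun p hp ↦ ⟨(p.1, p.2), by simpa using hp⟩) ?_ ?_ ?_ ?_ ?_
    · intro d _; simp
    · intro p hp; simp
    · intro d _; rfl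
    · intro p hp; rfl
    · intro d _; rfl
  rw [← h2, h1, ← Finset.mul_sum]; ring

variable (G) in
-- Summation by parts: reversing every link turns the weight `w j` into `-w i`.
theorem sum_mul_sum_neighborFinset (w : N → ℝ) (g : N → N → ℝ) (hg : ∀ i j, g j i = -g i j) :
    ∑ i, w i * ∑ j ∈ G.neighborFinset i, g i j =
      (1 / 2) * ∑ i, ∑ j ∈ G.neighborFinset i, (w i - w j) * g i j := by
  have hN : ∀ (h : N → N → ℝ) i, ∑ j ∈ G.neighborFinset i, h i j =
      ∑ j, if G.Adj i j then h i j else 0 := by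
    intro h i
    rw [← Finset.sum_filter]; congr 1; ext j; simp
  have hswap : ∑ i, ∑ j ∈ G.neighborFinset i, w j * g i j =
      -∑ i, ∑ j ∈ G.neighborFinset i, w i * g i j := by
    rw [Finset.sum_congr rfl fun i _ ↦ hN (fun i j ↦ w j * g i j) i,
      Finset.sum_congr rfl fun i _ ↦ hN (fun i j ↦ w i * g i j) i, Finset.sum_comm,
      ← Finset.sum_neg_distrib]
    refine Finset.sum_congr rfl fun j _ ↦ ?_
    rw [← Finset.sum_neg_distrib]
    refine Finset.sum_congr rfl fun i _ ↦ ?_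
    by_cases h : G.Adj i j
    · simp [h, h.symm, hg i j]
    · simp [h, mt G.adj_symm h]
  simp only [sub_mul, Finset.sum_sub_distrib, hswap, Finset.mul_sum]
  ring

theorem sum_cutIndicator_sub [DecidableEq N] (hG : G.IsAcyclic) {a b : N} (hab : G.Adj a b)
    (g : N → N → ℝ) :
    ∑ i, ∑ j ∈ G.neighborFinset i, (cutIndicator G a b i - cutIndicator G a b j) * g i j =
      g a b - g b a := by
  have : ∀ i, ∑ j ∈ G.neighborFinset i, (cutIndicator G a b i - cutIndicator G a b j) * g i j =
      (if i = a then g a b else 0) - (if i = b then g b a else 0) := by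
    intro i
    rw [Finset.sum_congr rfl (g := fun j ↦ (if j = b then (if i = a then g a b else 0) else 0)
      - (if j = a then (if i = b then g b a else 0) else 0))]
    · rw [Finset.sum_sub_distrib, Finset.sum_ite_eq', Finset.sum_ite_eq']
      congr 1
      · by_cases h : i = a
        · subst h; simp [hab]
        · simp [h]
      · by_cases h : i = b
        · subst h; simp [hab.symm]
        · simp [h]
    · intro j hj
      rw [cutIndicator_sub hG hab (by simpa using hj)]
      grind
  simp [this]

/-- On a forest every antisymmetric function on links is a difference of node values. -/
theorem exists_forall_adj_sub_eq [DecidableEq N] (hG : G.IsAcyclic) (g : N → N → ℝ)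
    (hg : ∀ i j, g j i = -g i j) :
    ∃ s : N → ℝ, ∀ i j, G.Adj i j → s i - s j = g i j := by
  -- Superpose the cut indicators of all links, weighted by `g`. Both orientations of a link give
  -- the same jump, hence the factor 1/2.
  refine ⟨fun k ↦ (1 / 2) * ∑ a, ∑ b ∈ G.neighborFinset a, g a b * cutIndicator G a b k,
    fun i j hij ↦ ?_⟩
  rw [← mul_sub, ← Finset.sum_sub_distrib]
  have : ∀ a, (∑ b ∈ G.neighborFinset a, g a b * cutIndicator G a b i) -
      (∑ b ∈ G.neighborFinset a, g a b * cutIndicator G a b j) =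
      (if i = a then g i j else 0) - (if j = a then g j i else 0) := by
    intro a
    rw [← Finset.sum_sub_distrib,
      Finset.sum_congr rfl (g := fun b ↦ (if j = b then (if i = a then g i j else 0) else 0)
        - (if i = b then (if j = a then g j i else 0) else 0))]
    · rw [Finset.sum_sub_distrib, Finset.sum_ite_eq, Finset.sum_ite_eq]
      congr 1
      · by_cases h : i = a
        · subst h; simp [hij]
        · simp [h]
      · by_cases h : j = a
        · subst h; simp [hij.symm]
        · simp [h]
    · intro b hb
      rw [← mul_sub, cutIndicator_sub hG (by simpa using hb) hij]
      grind
  simp only [this]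
  simp only [Finset.sum_sub_distrib, Finset.sum_ite_eq, Finset.mem_univ, if_true, hg i j]
  ring

/-- A Poincaré inequality for connected graphs. -/
theorem sum_sq_le_mul_sum_sq_sub (hG : G.Connected) {w : N → ℝ} (hw : ∑ i, w i = 0) :
    ∑ i, w i ^ 2 ≤ (Fintype.card N : ℝ) ^ 3 *
      ∑ i, ∑ j ∈ G.neighborFinset i, (w i - w j) ^ 2 := by
  set S := ∑ i, ∑ j ∈ G.neighborFinset i, (w i - w j) ^ 2 with hSdef
  have hnn : ∀ i, 0 ≤ ∑ j ∈ G.neighborFinset i, (w i - w j) ^ 2 :=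
    fun i ↦ Finset.sum_nonneg fun j _ ↦ sq_nonneg _
  have hS0 : 0 ≤ S := Finset.sum_nonneg fun i _ ↦ hnn i
  have hlink : ∀ i j, G.Adj i j → |w i - w j| ≤ √S := by
    intro i j hij
    refine Real.abs_le_sqrt ?_
    exact (Finset.single_le_sum (f := fun j ↦ (w i - w j) ^ 2) (fun j _ ↦ sq_nonneg _)
      (by simpa using hij)).trans
      (Finset.single_le_sum (fun i _ ↦ hnn i) (Finset.mem_univ i))
  -- Squaring this bound gives two factors of the node count; summing over nodes gives the third.
  have hb := abs_le_of_sum_eq_zero hw (abs_sub_le_card_mul hG (Real.sqrt_nonneg S) hlink)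
  calc ∑ i, w i ^ 2 ≤ ∑ _i : N, ((Fintype.card N : ℝ) ^ 2 * S) := by
        refine Finset.sum_le_sum fun i _ ↦ ?_
        have := pow_le_pow_left₀ (abs_nonneg _) (hb i) 2
        rwa [sq_abs, mul_pow, Real.sq_sqrt hS0] at this
    _ = (Fintype.card N : ℝ) ^ 3 * S := by simp; ring

end Graph

/-! ### The quotient by constants -/

section StateSpace

variable {N : Type*}

theorem toState_surjective : Function.Surjective (toState : (N → ℝ) → StateSpace N) :=
  Submodule.Quotient.mk_surjective _

theorem continuous_toState : Continuous (toState : (N → ℝ) → StateSpace N) :=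
  continuous_quot_mk

theorem continuous_diff (i j : N) : Continuous (diff i j) := by
  refine continuous_quot_lift _ ?_
  change Continuous fun u : N → ℝ ↦ u i - u j
  fun_prop

theorem toState_eq_toState_iff {u v : N → ℝ} :
    toState u = toState v ↔ ∀ i j, u i - u j = v i - v j := by
  refine ⟨fun h i j ↦ by rw [← diff_toState, h, diff_toState], fun h ↦ ?_⟩
  refine (Submodule.Quotient.eq _).mpr (Submodule.mem_span_singleton.mpr ?_)
  rcases isEmpty_or_nonempty N with _ | ⟨⟨k⟩⟩
  · exact ⟨0, funext fun i ↦ isEmptyElim i⟩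
  · refine ⟨u k - v k, funext fun i ↦ ?_⟩
    simp only [Pi.smul_apply, Pi.one_apply, smul_eq_mul, mul_one, Pi.sub_apply]
    linarith [h i k]

theorem exists_toState_eq_sum_eq_zero [Fintype N] (x : StateSpace N) :
    ∃ u : N → ℝ, toState u = x ∧ ∑ i, u i = 0 := by
  obtain ⟨v, rfl⟩ := toState_surjective x
  refine ⟨fun i ↦ v i - (∑ j, v j) / Fintype.card N, toState_eq_toState_iff.mpr fun i j ↦ by ring, ?_⟩
  rcases isEmpty_or_nonempty N with _ | _
  · simp
  · have : (Fintype.card N : ℝ) ≠ 0 := by exact_mod_cast Fintype.card_ne_zero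
    rw [Finset.sum_sub_distrib, Finset.sum_const, Finset.card_univ, nsmul_eq_mul]
    field_simp
    ring

/-- In a connected graph a state is determined by its link differences. -/
theorem ext_of_adj [Fintype N] {G : SimpleGraph N} (hG : G.Connected) {x y : StateSpace N}
    (h : ∀ i j, G.Adj i j → diff i j x = diff i j y) : x = y := by
  obtain ⟨u, rfl⟩ := toState_surjective x
  obtain ⟨v, rfl⟩ := toState_surjective y
  simp only [diff_toState] at h
  refine toState_eq_toState_iff.mpr fun i j ↦ ?_
  have h0 := abs_sub_le_card_mul hG (w := fun i ↦ u i - v i) (S := 0) le_rfl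
    (fun i j hij ↦ by
      have h1 := h i j hij
      have h2 : u i - v i - (u j - v j) = 0 := by linarith
      rw [h2, abs_zero]) i j
  rw [mul_zero] at h0
  have := abs_nonpos_iff.mp h0
  linarith

end StateSpace

/-! ### The potential along solutions -/

section Dynamics

variable {N : Type*} [Fintype N] {G : SimpleGraph N} [DecidableRel G.Adj] [DecidableEq N] {r : ℝ}

theorem velocity_toState (u : N → ℝ) (i : N) : velocity G r (toState u) i =
    ∑ j ∈ G.neighborFinset i, (r * (u i - u j) - (u i - u j) ^ 3) := by
  simp [velocity]

theorem sum_mul_velocity (w : N → ℝ) (x : StateSpace N) :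
    ∑ i, w i * velocity G r x i = (1 / 2) * ∑ i, ∑ j ∈ G.neighborFinset i,
      (w i - w j) * (r * diff i j x - diff i j x ^ 3) :=
  sum_mul_sum_neighborFinset G w (fun i j ↦ r * diff i j x - diff i j x ^ 3)
    fun i j ↦ by rw [diff_swap i j]; ring

theorem sum_velocity (x : StateSpace N) : ∑ i, velocity G r x i = 0 := by
  simpa using sum_mul_velocity (G := G) (r := r) (fun _ ↦ 1) x

theorem potential_eq_sum (x : StateSpace N) : potential G r x =
    (1 / 8) * ∑ i, ∑ j ∈ G.neighborFinset i, diff i j x ^ 2 * (diff i j x ^ 2 - 2 * r) := by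
  rw [potential, sum_edgeFinset_eq_half_sum]
  simp only [Sym2.lift_mk]
  ring

theorem continuous_potential : Continuous (potential G r) := by
  have : potential G r = _ := funext potential_eq_sum
  rw [this]
  have := continuous_diff (N := N)
  fun_prop

/-- Adding $r^2$ to a link term gives $(y^2-r)^2 \ge 0$, so the other $L-1$ links together
contribute at least $-(L-1)r^2$. This is what singles out $V_c$. -/
theorem le_four_mul_potential (x : StateSpace N) {i j : N} (hij : G.Adj i j) :
    diff i j x ^ 2 * (diff i j x ^ 2 - 2 * r) ≤
      4 * potential G r x + ((G.edgeFinset.card : ℝ) - 1) * r ^ 2 := by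
  set f : Sym2 N → ℝ := Sym2.lift ⟨fun i j ↦ diff i j x ^ 2 * (diff i j x ^ 2 - 2 * r),
    fun i j ↦ by simp only [diff_swap i j x, neg_sq]⟩ with hf
  have hnn : ∀ e, 0 ≤ f e + r ^ 2 := by
    intro e
    induction e with
    | _ a b =>
      have : f s(a, b) + r ^ 2 = (diff a b x ^ 2 - r) ^ 2 := by
        simp only [hf, Sym2.lift_mk]; ring
      rw [this]; positivity
  have h1 := Finset.single_le_sum (f := fun e ↦ f e + r ^ 2) (fun e _ ↦ hnn e)
    (a := s(i, j)) (s := G.edgeFinset) (by simpa using hij)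
  rw [Finset.sum_add_distrib, Finset.sum_const, nsmul_eq_mul] at h1
  have h2 : 4 * potential G r x = ∑ e ∈ G.edgeFinset, f e := by rw [potential]; ring
  have h3 : f s(i, j) = diff i j x ^ 2 * (diff i j x ^ 2 - 2 * r) := by
    simp only [hf, Sym2.lift_mk]
  rw [h2, ← h3]
  linarith

theorem diff_sq_mul_neg_of_mem_subcritical {x : StateSpace N} (hx : x ∈ subcritical G r) {i j : N}
    (hij : G.Adj i j) : diff i j x ^ 2 * (diff i j x ^ 2 - 2 * r) < 0 := by
  have h : potential G r x < -((G.edgeFinset.card : ℝ) - 1) * r ^ 2 / 4 := hx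
  linarith [le_four_mul_potential (r := r) x hij]

theorem diff_ne_zero_of_mem_subcritical {x : StateSpace N} (hx : x ∈ subcritical G r) {i j : N}
    (hij : G.Adj i j) : diff i j x ≠ 0 := fun h ↦ by
  simpa [h] using diff_sq_mul_neg_of_mem_subcritical hx hij

theorem diff_sq_lt_of_mem_subcritical {x : StateSpace N} (hx : x ∈ subcritical G r) {i j : N}
    (hij : G.Adj i j) : diff i j x ^ 2 < 2 * r := by
  have h := diff_sq_mul_neg_of_mem_subcritical hx hij
  nlinarith [sq_nonneg (diff i j x)]

/-- The system is the gradient flow of the potential. -/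
theorem hasDerivWithinAt_potential {u : ℝ → N → ℝ} {u' : N → ℝ} {s : Set ℝ} {t : ℝ}
    (hu : ∀ i, HasDerivWithinAt (fun a ↦ u a i) (u' i) s t) :
    HasDerivWithinAt (fun a ↦ potential G r (toState (u a)))
      (-∑ i, u' i * velocity G r (toState (u t)) i) s t := by
  have h1 : HasDerivWithinAt (fun a ↦ (1 / 8) * ∑ i, ∑ j ∈ G.neighborFinset i,
      (u a i - u a j) ^ 2 * ((u a i - u a j) ^ 2 - 2 * r))
      ((1 / 8) * ∑ i, ∑ j ∈ G.neighborFinset i,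
        (4 * (u t i - u t j) ^ 3 - 4 * r * (u t i - u t j)) * (u' i - u' j)) s t := by
    refine HasDerivWithinAt.const_mul _ (HasDerivWithinAt.fun_sum fun i _ ↦
      HasDerivWithinAt.fun_sum fun j _ ↦ ?_)
    have hd := (hu i).fun_sub (hu j)
    refine ((hd.fun_pow 2).fun_mul ((hd.fun_pow 2).sub_const (2 * r))).congr_deriv ?_
    simp only [Nat.cast_ofNat]
    ring
  refine (h1.congr_deriv ?_).congr (fun a _ ↦ by simp [potential_eq_sum])
    (by simp [potential_eq_sum])
  rw [sum_mul_velocity, Finset.mul_sum, Finset.mul_sum, ← Finset.sum_neg_distrib]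
  refine Finset.sum_congr rfl fun i _ ↦ ?_
  rw [Finset.mul_sum, Finset.mul_sum, ← Finset.sum_neg_distrib]
  refine Finset.sum_congr rfl fun j _ ↦ ?_
  rw [diff_toState]
  ring

theorem antitoneOn_Ici_of_hasDerivWithinAt {f f' : ℝ → ℝ}
    (hf : ∀ t, 0 ≤ t → HasDerivWithinAt f (f' t) (Set.Ici 0) t) (hf' : ∀ t, 0 ≤ t → f' t ≤ 0) :
    AntitoneOn f (Set.Ici 0) := by
  refine antitoneOn_of_hasDerivWithinAt_nonpos (f' := f') (convex_Ici 0)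
    (fun t ht ↦ (hf t ht).continuousWithinAt) ?_ ?_
  · intro t ht
    exact (hf t (interior_subset ht)).mono interior_subset
  · intro t ht
    exact hf' t (interior_subset ht)

theorem IsSolution.potential_antitoneOn {u : ℝ → N → ℝ} (hu : IsSolution G r u) :
    AntitoneOn (fun t ↦ potential G r (toState (u t))) (Set.Ici 0) :=
  antitoneOn_Ici_of_hasDerivWithinAt (fun t ht ↦ hasDerivWithinAt_potential (hu t ht))
    fun _ _ ↦ neg_nonpos.mpr (Finset.sum_nonneg fun _ _ ↦ mul_self_nonneg _)

theorem IsSolution.mem_subcritical {u : ℝ → N → ℝ} (hu : IsSolution G r u)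
    (h0 : toState (u 0) ∈ subcritical G r) {t : ℝ} (ht : 0 ≤ t) :
    toState (u t) ∈ subcritical G r :=
  (hu.potential_antitoneOn Set.self_mem_Ici ht ht).trans_lt h0

/-- Below the critical potential, link differences keep their signs. -/
theorem IsSolution.diff_mul_pos {u : ℝ → N → ℝ} (hu : IsSolution G r u)
    (h0 : toState (u 0) ∈ subcritical G r) {t : ℝ} (ht : 0 ≤ t) {i j : N} (hij : G.Adj i j) :
    0 < diff i j (toState (u 0)) * diff i j (toState (u t)) := by
  by_contra! hle
  have h00 : 0 ≤ diff i j (toState (u 0)) * diff i j (toState (u 0)) := mul_self_nonneg _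
  have hcont : ContinuousOn (fun a ↦ diff i j (toState (u 0)) * diff i j (toState (u a)))
      (Set.Icc 0 t) := by
    intro a ha
    simp only [diff_toState]
    exact (((hu a ha.1 i).fun_sub (hu a ha.1 j)).const_mul _).continuousWithinAt.mono
      Set.Icc_subset_Ici_self
  obtain ⟨a, ha, haz⟩ := intermediate_value_Icc' ht hcont ⟨hle, h00⟩
  -- A sign change would pass through a zero difference, impossible below $V_c$.
  exact mul_ne_zero (diff_ne_zero_of_mem_subcritical h0 hij)
    (diff_ne_zero_of_mem_subcritical (hu.mem_subcritical h0 ha.1) hij) haz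

theorem mem_subcritical_of_mem_basin {x xs : StateSpace N} (hx : x ∈ basin G r xs)
    (hsub : x ∈ subcritical G r) : xs ∈ subcritical G r := by
  obtain ⟨u, hu, rfl, hlim⟩ := hx
  refine lt_of_le_of_lt (le_of_tendsto ((continuous_potential.tendsto xs).comp hlim) ?_) hsub
  filter_upwards [eventually_ge_atTop 0] with t ht
  exact hu.potential_antitoneOn Set.self_mem_Ici ht ht

/-- Signs persist along the solution, giving `≥ 0` in the limit; the limit is itself subcritical,
which makes it strict. -/
theorem diff_mul_pos_of_mem_basin {x xs : StateSpace N} (hx : x ∈ basin G r xs)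
    (hsub : x ∈ subcritical G r) {i j : N} (hij : G.Adj i j) : 0 < diff i j x * diff i j xs := by
  have hxs := mem_subcritical_of_mem_basin hx hsub
  obtain ⟨u, hu, rfl, hlim⟩ := hx
  have hne := mul_ne_zero (diff_ne_zero_of_mem_subcritical hsub hij)
    (diff_ne_zero_of_mem_subcritical hxs hij)
  refine lt_of_le_of_ne (ge_of_tendsto
    ((((continuous_diff i j).tendsto xs).comp hlim).const_mul (diff i j (toState (u 0)))) ?_) hne.symm
  filter_upwards [eventually_ge_atTop 0] with t ht
  exact (hu.diff_mul_pos hsub ht hij).le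

end Dynamics

/-! ### Stationary and stable states -/

section Equilibria

variable {N : Type*} {G : SimpleGraph N} {r : ℝ}

theorem isFullDissensus_iff (hr : 0 ≤ r) {x : StateSpace N} :
    IsFullDissensus G r x ↔ ∀ i j, G.Adj i j → diff i j x ^ 2 = r := by
  refine forall₃_congr fun i j _ ↦ ?_
  rw [← sq_eq_sq_iff_eq_or_eq_neg, Real.sq_sqrt hr]

variable [Fintype N] [DecidableRel G.Adj]

variable [DecidableEq N]

/-- On a forest, stationarity makes the flow through every link vanish. -/
theorem IsStationaryState.link_flow_eq_zero (hG : G.IsAcyclic) {x : StateSpace N}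
    (hx : IsStationaryState G r x) {a b : N} (hab : G.Adj a b) :
    r * diff a b x - diff a b x ^ 3 = 0 := by
  have h := sum_mul_velocity (G := G) (r := r) (cutIndicator G a b) x
  rw [sum_cutIndicator_sub hG hab (fun i j ↦ r * diff i j x - diff i j x ^ 3)] at h
  simp only [hx _, mul_zero, Finset.sum_const_zero, diff_swap a b x] at h
  linarith

theorem IsStationaryState.diff_sq_eq (hG : G.IsAcyclic) {x : StateSpace N}
    (hx : IsStationaryState G r x) {a b : N} (hab : G.Adj a b) (hne : diff a b x ≠ 0) :
    diff a b x ^ 2 = r := by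
  have h : diff a b x * (r - diff a b x ^ 2) = 0 := by
    linear_combination hx.link_flow_eq_zero hG hab
  linarith [(mul_eq_zero.mp h).resolve_left hne]

theorem IsFullDissensus.isStationaryState (hr : 0 ≤ r) {x : StateSpace N}
    (hx : IsFullDissensus G r x) : IsStationaryState G r x := by
  intro i
  refine Finset.sum_eq_zero fun j hj ↦ ?_
  have := (isFullDissensus_iff hr).mp hx i j (by simpa using hj)
  linear_combination -diff i j x * this

theorem jacobian_apply (x : StateSpace N) (i k : N) :
    jacobian G r x i k = ∑ j ∈ G.neighborFinset i, (r - 3 * diff i j x ^ 2) *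
      (Pi.single (M := fun _ ↦ ℝ) k 1 i - Pi.single (M := fun _ ↦ ℝ) k 1 j) := by
  refine HasDerivAt.deriv ?_
  simp only [velocity]
  refine HasDerivAt.fun_sum fun j _ ↦ ?_
  have hsingle : ∀ l : N, HasDerivAt (fun s : ℝ ↦ Pi.single (M := fun _ ↦ ℝ) k s l)
      (Pi.single (M := fun _ ↦ ℝ) k 1 l) 0 := by
    intro l
    by_cases h : l = k
    · subst h; simpa using hasDerivAt_id' (0 : ℝ)
    · simpa [h] using hasDerivAt_const (0 : ℝ) (0 : ℝ)
  have hd : HasDerivAt (fun s : ℝ ↦ diff i j (x + toState (Pi.single k s)))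
      (Pi.single (M := fun _ ↦ ℝ) k 1 i - Pi.single (M := fun _ ↦ ℝ) k 1 j) 0 := by
    simp only [map_add, diff_toState]
    exact ((hsingle i).fun_sub (hsingle j)).const_add _
  refine ((hd.const_mul r).fun_sub (hd.fun_pow 3)).congr_deriv ?_
  simp only [map_add, diff_toState, Pi.single_zero, Pi.zero_apply, sub_zero, add_zero,
    Nat.cast_ofNat]
  ring

theorem jacobian_mulVec (x : StateSpace N) (w : N → ℝ) (i : N) :
    (jacobian G r x).mulVec w i =
      ∑ j ∈ G.neighborFinset i, (r - 3 * diff i j x ^ 2) * (w i - w j) := by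
  simp only [Matrix.mulVec, dotProduct, jacobian_apply, Finset.sum_mul]
  rw [Finset.sum_comm]
  refine Finset.sum_congr rfl fun j _ ↦ ?_
  simp only [mul_assoc, ← Finset.mul_sum, sub_mul, Finset.sum_sub_distrib]
  simp [Pi.single_apply]

/-- The Jacobian is a weighted Laplacian, so stability depends on the link weights $r - 3y^2$. They
equal $-2r$ at full dissensus and $r$ at a vanishing difference. -/
theorem dotProduct_jacobian_mulVec (x : StateSpace N) (w : N → ℝ) :
    w ⬝ᵥ (jacobian G r x).mulVec w = (1 / 2) * ∑ i, ∑ j ∈ G.neighborFinset i,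
      (w i - w j) * ((r - 3 * diff i j x ^ 2) * (w i - w j)) := by
  simp only [dotProduct, jacobian_mulVec]
  exact sum_mul_sum_neighborFinset G w (fun i j ↦ (r - 3 * diff i j x ^ 2) * (w i - w j))
    fun i j ↦ by rw [diff_swap i j]; ring

theorem IsFullDissensus.isStable (hG : G.Connected) (hr : 0 < r) {x : StateSpace N}
    (hx : IsFullDissensus G r x) : IsStable G r x := by
  refine ⟨hx.isStationaryState hr.le, fun w hw ↦ ?_⟩
  obtain ⟨a, b, hab, hne⟩ : ∃ a b, G.Adj a b ∧ w a - w b ≠ 0 := by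
    by_contra! h
    exact hw (ext_of_adj hG fun i j hij ↦ by rw [diff_toState, h i j hij, map_zero])
  rw [dotProduct_jacobian_mulVec]
  have hle : ∀ i, ∀ j ∈ G.neighborFinset i,
      (w i - w j) * ((r - 3 * diff i j x ^ 2) * (w i - w j)) = -(2 * r * (w i - w j) ^ 2) := by
    intro i j hj
    rw [(isFullDissensus_iff hr.le).mp hx i j (by simpa using hj)]
    ring
  rw [Finset.sum_congr rfl fun i _ ↦ Finset.sum_congr rfl (hle i)]
  simp only [Finset.sum_neg_distrib, mul_neg, Left.neg_neg_iff]
  refine mul_pos (by norm_num) (Finset.sum_pos' (fun i _ ↦ Finset.sum_nonneg fun j _ ↦ by positivity)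
    ⟨a, Finset.mem_univ a, Finset.sum_pos' (fun j _ ↦ by positivity) ⟨b, by simpa using hab, ?_⟩⟩)
  positivity

theorem IsStable.isFullDissensus (hG : G.IsAcyclic) (hr : 0 < r) {x : StateSpace N}
    (hx : IsStable G r x) : IsFullDissensus G r x := by
  refine (isFullDissensus_iff hr.le).mpr fun a b hab ↦ hx.1.diff_sq_eq hG hab fun h0 ↦ ?_
  have h1 : cutIndicator G a b a - cutIndicator G a b b = 1 := by
    rw [cutIndicator_left, cutIndicator_right hG hab, sub_zero]
  have hne : toState (cutIndicator G a b) ≠ 0 := fun h ↦ by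
    rw [← diff_toState, h, map_zero] at h1
    exact zero_ne_one h1
  have h := hx.2 _ hne
  -- The cut indicator sees only the link `ab`, so the form takes the value `r > 0`.
  rw [dotProduct_jacobian_mulVec, sum_cutIndicator_sub hG hab
    (fun i j ↦ (r - 3 * diff i j x ^ 2) * (cutIndicator G a b i - cutIndicator G a b j)),
    diff_swap a b, h0, ← neg_sub (cutIndicator G a b a), h1] at h
  linarith

theorem IsStationaryState.isFullDissensus_of_mem_subcritical (hG : G.IsAcyclic) (hr : 0 ≤ r)
    {x : StateSpace N} (hx : IsStationaryState G r x) (hsub : x ∈ subcritical G r) :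
    IsFullDissensus G r x :=
  (isFullDissensus_iff hr).mpr fun _ _ hij ↦
    hx.diff_sq_eq hG hij (diff_ne_zero_of_mem_subcritical hsub hij)

theorem IsFullDissensus.mem_subcritical (hr : 0 < r) {x : StateSpace N}
    (hx : IsFullDissensus G r x) : x ∈ subcritical G r := by
  have h : potential G r x = -(G.edgeFinset.card * r ^ 2) / 4 := by
    rw [potential, Finset.sum_congr rfl (g := fun _ ↦ -r ^ 2), Finset.sum_const, nsmul_eq_mul]
    · ring
    · intro e he
      induction e with
      | _ a b =>
        rw [Sym2.lift_mk]
        dsimp only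
        rw [(isFullDissensus_iff hr.le).mp hx a b (by simpa using he)]
        ring
  change potential G r x < -((G.edgeFinset.card : ℝ) - 1) * r ^ 2 / 4
  rw [h]
  nlinarith [pow_pos hr 2]

/-- A full-dissensus state is determined by the signs of its link differences. -/
theorem IsFullDissensus.eq_of_forall_diff_mul_pos (hG : G.Connected) (hr : 0 ≤ r)
    {x y z : StateSpace N} (hx : IsFullDissensus G r x) (hy : IsFullDissensus G r y)
    (hzx : ∀ i j, G.Adj i j → 0 < diff i j z * diff i j x)
    (hzy : ∀ i j, G.Adj i j → 0 < diff i j z * diff i j y) : x = y := by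
  refine ext_of_adj hG fun i j hij ↦ ?_
  have h := ((isFullDissensus_iff hr).mp hx i j hij).trans
    ((isFullDissensus_iff hr).mp hy i j hij).symm
  refine (sq_eq_sq_iff_eq_or_eq_neg.mp h).resolve_right fun h' ↦ ?_
  have h1 := hzx i j hij
  have h2 := hzy i j hij
  rw [h'] at h1
  linarith

theorem exists_isFullDissensus_diff_mul_pos (hG : G.IsAcyclic) (hr : 0 < r) {x : StateSpace N}
    (hx : ∀ i j, G.Adj i j → diff i j x ≠ 0) :
    ∃ xs, IsFullDissensus G r xs ∧ ∀ i j, G.Adj i j → 0 < diff i j x * diff i j xs := by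
  obtain ⟨s, hs⟩ := exists_forall_adj_sub_eq hG (fun i j ↦ SignType.sign (diff i j x) * √r)
    (fun i j ↦ by rw [diff_swap i j, Left.sign_neg]; simp)
  refine ⟨toState s, (isFullDissensus_iff hr.le).mpr fun i j hij ↦ ?_, fun i j hij ↦ ?_⟩ <;>
    rw [diff_toState, hs i j hij] <;> rcases (hx i j hij).lt_or_gt with h | h
  · simp [sign_neg h, Real.sq_sqrt hr.le]
  · simp [sign_pos h, Real.sq_sqrt hr.le]
  · simpa [sign_neg h] using mul_neg_of_neg_of_pos h (Real.sqrt_pos.mpr hr)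
  · simpa [sign_pos h] using mul_pos h (Real.sqrt_pos.mpr hr)

end Equilibria


/-! ### Global existence and exponential convergence -/

section Convergence

variable {N : Type*} [Fintype N] [DecidableEq N] {G : SimpleGraph N} [DecidableRel G.Adj] {r : ℝ}

theorem contDiff_velocity_toState :
    ContDiff ℝ 1 fun u : N → ℝ ↦ fun i ↦ velocity G r (toState u) i := by
  simp only [velocity_toState]
  fun_prop

/-- A nonnegative cutoff factor still lets $V$ decrease and conserves the mean. Hence link
differences stay below $\sqrt{2r}$ and the solution stays in the ball where the factor is 1. -/
theorem exists_isSolution (hG : G.Connected) {v : N → ℝ} (hv : ∑ i, v i = 0)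
    (hsub : toState v ∈ subcritical G r) :
    ∃ u : ℝ → N → ℝ, IsSolution G r u ∧ u 0 = v := by
  set R := (Fintype.card N : ℝ) * √(2 * r) with hR
  obtain ⟨χ, u, hχ, hχ1, hu0, hu⟩ :=
    exists_cutoff_solution (contDiff_velocity_toState (G := G) (r := r)) v R
  have hu' : ∀ t, 0 ≤ t → ∀ i, HasDerivWithinAt (fun s ↦ u s i)
      (χ (u t) * velocity G r (toState (u t)) i) (Set.Ici 0) t := fun t _ i ↦
    ((hasDerivAt_pi.mp (hu t)) i).hasDerivWithinAt
  have hmem : ∀ t, 0 ≤ t → toState (u t) ∈ subcritical G r := by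
    intro t ht
    have hanti := antitoneOn_Ici_of_hasDerivWithinAt
      (fun t ht ↦ hasDerivWithinAt_potential (G := G) (r := r) (hu' t ht)) fun t _ ↦
        neg_nonpos.mpr (Finset.sum_nonneg fun i _ ↦ by
          rw [mul_assoc]; exact mul_nonneg (hχ _) (mul_self_nonneg _))
    exact (hanti Set.self_mem_Ici ht ht).trans_lt (by simpa only [hu0] using Set.mem_ofPred.mp hsub)
  have hsum : ∀ t, ∑ i, u t i = 0 := by
    intro t
    have hd : ∀ t, HasDerivAt (fun s ↦ ∑ i, u s i) 0 t := fun t ↦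
      (HasDerivAt.fun_sum fun i _ ↦ hasDerivAt_pi.mp (hu t) i).congr_deriv (by
        simp [← Finset.mul_sum, sum_velocity])
    have := is_const_of_deriv_eq_zero (fun t ↦ (hd t).differentiableAt) (fun t ↦ (hd t).deriv) t 0
    rw [this, hu0, hv]
  refine ⟨u, fun t ht i ↦ (hu' t ht i).congr_deriv ?_, hu0⟩
  rw [hχ1, one_mul]
  refine (pi_norm_le_iff_of_nonneg (by positivity)).mpr fun i ↦ ?_
  refine abs_le_of_sum_eq_zero (hsum t) (abs_sub_le_card_mul hG (Real.sqrt_nonneg _) ?_) i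
  intro i j hij
  rw [← diff_toState]
  exact Real.abs_le_sqrt (diff_sq_lt_of_mem_subcritical (hmem t ht) hij).le

/-- Grönwall: $e^{kt} f(t)$ is nonincreasing. -/
theorem tendsto_zero_of_hasDerivWithinAt_le {f f' : ℝ → ℝ} {k : ℝ} (hk : 0 < k)
    (hnn : ∀ t, 0 ≤ f t) (hf : ∀ t, 0 ≤ t → HasDerivWithinAt f (f' t) (Set.Ici 0) t)
    (hf' : ∀ t, 0 ≤ t → f' t ≤ -(k * f t)) : Tendsto f atTop (𝓝 0) := by
  have hd : ∀ t, 0 ≤ t → HasDerivWithinAt (fun s ↦ Real.exp (k * s) * f s)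
      (Real.exp (k * t) * (k * f t + f' t)) (Set.Ici 0) t := by
    intro t ht
    have he : HasDerivAt (fun s ↦ Real.exp (k * s)) (Real.exp (k * t) * k) t := by
      simpa using ((hasDerivAt_id' t).const_mul k).exp
    exact (he.hasDerivWithinAt.fun_mul (hf t ht)).congr_deriv (by ring)
  have hanti := antitoneOn_Ici_of_hasDerivWithinAt hd fun t ht ↦
    mul_nonpos_of_nonneg_of_nonpos (Real.exp_pos _).le (by linarith [hf' t ht])
  have hlim : Tendsto (fun t ↦ Real.exp (-(k * t)) * f 0) atTop (𝓝 0) := by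
    simpa using (Real.tendsto_exp_neg_atTop_nhds_zero.comp
      (tendsto_id.const_mul_atTop hk)).mul_const (f 0)
  refine tendsto_of_tendsto_of_tendsto_of_le_of_le' tendsto_const_nhds hlim
    (Eventually.of_forall hnn) ?_
  filter_upwards [eventually_ge_atTop 0] with t ht
  have h := hanti Set.self_mem_Ici ht ht
  simp only [mul_zero, Real.exp_zero, one_mul] at h
  have := mul_le_mul_of_nonneg_left h (Real.exp_pos (-(k * t))).le
  rwa [← mul_assoc, ← Real.exp_add, neg_add_cancel, Real.exp_zero, one_mul] at this

/-- Solutions starting below the critical potential converge to the full-dissensus state with the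
same signs of link differences. -/
theorem IsSolution.tendsto_of_isFullDissensus (hG : G.Connected) (hr : 0 < r) {u : ℝ → N → ℝ}
    (hu : IsSolution G r u) (hsub : toState (u 0) ∈ subcritical G r) {s : N → ℝ}
    (hs : IsFullDissensus G r (toState s))
    (hpos : ∀ i j, G.Adj i j → 0 < diff i j (toState (u 0)) * diff i j (toState s))
    (hsum : ∑ i, u 0 i = ∑ i, s i) : Tendsto u atTop (𝓝 s) := by
  have hsum' : ∀ t, 0 ≤ t → ∑ i, (u t i - s i) = 0 := by
    intro t ht
    have hd : ∀ t, 0 ≤ t → HasDerivWithinAt (fun a ↦ ∑ i, u a i) 0 (Set.Ici 0) t := fun t ht ↦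
      (HasDerivWithinAt.fun_sum fun i _ ↦ hu t ht i).congr_deriv (sum_velocity _)
    have h1 := antitoneOn_Ici_of_hasDerivWithinAt hd (fun _ _ ↦ le_rfl) Set.self_mem_Ici ht ht
    have h2 := antitoneOn_Ici_of_hasDerivWithinAt
      (fun t ht ↦ (hd t ht).fun_neg) (fun _ _ ↦ neg_zero.le) Set.self_mem_Ici ht ht
    rw [Finset.sum_sub_distrib, ← hsum]
    simp only at h1 h2
    linarith
  -- With this `c` the link bound reads $y^4 - 2ry^2 \le -2rc$ at all times, hence $y^2 \ge c$.
  set c := -(4 * potential G r (toState (u 0)) + ((G.edgeFinset.card : ℝ) - 1) * r ^ 2) / (2 * r)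
    with hc
  have hc0 : 0 < c := by
    have h : potential G r (toState (u 0)) < -((G.edgeFinset.card : ℝ) - 1) * r ^ 2 / 4 := hsub
    exact div_pos (by linarith) (by linarith)
  have hlow : ∀ t, 0 ≤ t → ∀ i j, G.Adj i j → c ≤ (u t i - u t j) ^ 2 := by
    intro t ht i j hij
    have h1 := le_four_mul_potential (r := r) (toState (u t)) hij
    have h2 : potential G r (toState (u t)) ≤ _ := hu.potential_antitoneOn Set.self_mem_Ici ht ht
    rw [diff_toState] at h1
    rw [hc, div_le_iff₀ (by linarith)]
    nlinarith [sq_nonneg ((u t i - u t j) ^ 2)]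
  have hpos' : ∀ t, 0 ≤ t → ∀ i j, G.Adj i j → 0 < (u t i - u t j) * (s i - s j) := by
    intro t ht i j hij
    have h1 := hu.diff_mul_pos hsub ht hij
    have h2 := hpos i j hij
    rw [diff_toState] at h1 h2
    rw [diff_toState] at h1 h2
    have h3 := mul_pos h1 h2
    have h4 : 0 < (u 0 i - u 0 j) ^ 2 := by
      have : u 0 i - u 0 j ≠ 0 := fun h ↦ by simp [h] at h1
      positivity
    refine pos_of_mul_pos_right (a := (u 0 i - u 0 j) ^ 2) ?_ h4.le
    linarith
  set n := (Fintype.card N : ℝ) ^ 3 with hn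
  have hn0 : 0 < n := by
    have := hG.nonempty
    have : (0 : ℝ) < Fintype.card N := by exact_mod_cast Fintype.card_pos
    positivity
  have hlim : Tendsto (fun t ↦ ∑ i, (u t i - s i) ^ 2) atTop (𝓝 0) := by
    refine tendsto_zero_of_hasDerivWithinAt_le (k := c / n) (div_pos hc0 hn0)
      (f' := fun t ↦ 2 * ∑ i, (u t i - s i) * velocity G r (toState (u t)) i)
      (fun t ↦ Finset.sum_nonneg fun i _ ↦ sq_nonneg _) (fun t ht ↦ ?_) (fun t ht ↦ ?_)
    · refine (HasDerivWithinAt.fun_sum fun i _ ↦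
        ((hu t ht i).sub_const (s i)).fun_pow 2).congr_deriv ?_
      rw [Finset.mul_sum]
      refine Finset.sum_congr rfl fun i _ ↦ ?_
      simp only [Nat.cast_ofNat]
      ring
    · have hP := sum_sq_le_mul_sum_sq_sub hG (hsum' t ht)
      rw [← hn] at hP
      have hle : ∑ i, ∑ j ∈ G.neighborFinset i,
          (u t i - s i - (u t j - s j)) * (r * (u t i - u t j) - (u t i - u t j) ^ 3) ≤
          ∑ i, ∑ j ∈ G.neighborFinset i, -(c * (u t i - s i - (u t j - s j)) ^ 2) := by
        refine Finset.sum_le_sum fun i _ ↦ Finset.sum_le_sum fun j hj ↦ ?_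
        have hij : G.Adj i j := by simpa using hj
        have h1 := hlow t ht i j hij
        have h2 := hpos' t ht i j hij
        have h3 := (isFullDissensus_iff hr.le).mp hs i j hij
        rw [diff_toState] at h3
        set y := u t i - u t j
        set z := s i - s j
        have h4 : u t i - s i - (u t j - s j) = y - z := by ring
        -- Since $z^2 = r$, the cubic factors; as $yz > 0$, the coefficient $y^2 + yz$ is at least
        -- `c`.
        have h5 : (y - z) * (r * y - y ^ 3) = -((y ^ 2 + y * z) * (y - z) ^ 2) := by
          rw [← h3]; ring
        rw [h4, h5, neg_le_neg_iff]
        exact mul_le_mul_of_nonneg_right (by linarith) (sq_nonneg _)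
      rw [sum_mul_velocity]
      simp only [diff_toState]
      simp only [Finset.sum_neg_distrib, ← Finset.mul_sum] at hle
      have h6 : c / n * ∑ i, (u t i - s i) ^ 2 ≤
          c * ∑ i, ∑ j ∈ G.neighborFinset i, (u t i - s i - (u t j - s j)) ^ 2 := by
        rw [div_mul_eq_mul_div, div_le_iff₀ hn0]
        nlinarith [mul_le_mul_of_nonneg_left hP hc0.le]
      linarith
  refine tendsto_pi_nhds.mpr fun i ↦ ?_
  rw [← tendsto_sub_nhds_zero_iff]
  refine squeeze_zero_norm (a := fun t ↦ √(∑ i, (u t i - s i) ^ 2)) (fun t ↦ ?_) ?_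
  · exact Real.abs_le_sqrt (Finset.single_le_sum (f := fun i ↦ (u t i - s i) ^ 2)
      (fun i _ ↦ sq_nonneg _) (Finset.mem_univ i))
  · simpa [Function.comp_def] using (Real.continuous_sqrt.tendsto 0).comp hlim

/-- The mean is conserved, so mean-zero representatives turn convergence of states into convergence
of vectors. -/
theorem mem_basin_of_isFullDissensus (hG : G.Connected) (hr : 0 < r) {x xs : StateSpace N}
    (hx : x ∈ subcritical G r) (hxs : IsFullDissensus G r xs)
    (hpos : ∀ i j, G.Adj i j → 0 < diff i j x * diff i j xs) : x ∈ basin G r xs := by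
  obtain ⟨v, rfl, hv⟩ := exists_toState_eq_sum_eq_zero x
  obtain ⟨s, rfl, hs⟩ := exists_toState_eq_sum_eq_zero xs
  obtain ⟨u, hu, rfl⟩ := exists_isSolution hG hv hx
  exact ⟨u, hu, rfl, (continuous_toState.tendsto s).comp
    (hu.tendsto_of_isFullDissensus hG hr hx hxs hpos (hv.trans hs.symm))⟩

theorem IsStationaryState.mem_basin_self {x : StateSpace N} (hx : IsStationaryState G r x) :
    x ∈ basin G r x := by
  obtain ⟨v, rfl⟩ := toState_surjective x
  refine ⟨fun _ ↦ v, fun t _ i ↦ ?_, rfl, tendsto_const_nhds⟩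
  rw [hx i]
  exact hasDerivWithinAt_const _ _ _

/-- Without positive coupling the region below the critical potential is empty, unless there are no
links. -/
theorem not_adj_of_mem_subcritical (hr : r ≤ 0) {x : StateSpace N} (hx : x ∈ subcritical G r)
    (i j : N) : ¬ G.Adj i j := fun hij ↦ by
  nlinarith [diff_sq_lt_of_mem_subcritical hx hij, sq_nonneg (diff i j x)]

end Convergence

end PitchforkNetwork

/-! ### The main theorem -/

open PitchforkNetwork
theorem proposition4 {N : Type*} [Fintype N] [DecidableEq N] (G : SimpleGraph N)
    [DecidableRel G.Adj] (hG : G.IsTree) (r : ℝ) :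
    -- the subcritical region is the union of the basins of the stable states, restricted to it,
    (subcritical G r = ⋃ xs ∈ {xs | IsStable G r xs}, basin G r xs ∩ subcritical G r) ∧
    -- these restricted basins are pairwise disjoint,
    ({xs | IsStable G r xs}.PairwiseDisjoint fun xs => basin G r xs ∩ subcritical G r) ∧
    -- and the basins of all other stationary states miss the region
    (∀ xs, IsStationaryState G r xs → ¬ IsStable G r xs → basin G r xs ∩ subcritical G r = ∅) ∧
    -- for `r > 0` the stable states are the full-dissensus states, and no part is empty
    (0 < r → ∀ xs, (IsStable G r xs ↔ IsFullDissensus G r xs) ∧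
      (IsStable G r xs → (basin G r xs ∩ subcritical G r).Nonempty)) ∧
    -- within the region a basin consists of the states with the same link-difference signs
    (∀ xs, IsStationaryState G r xs →
      basin G r xs ∩ subcritical G r =
        {x | ∀ i j, G.Adj i j → 0 < diff i j x * diff i j xs} ∩ subcritical G r) := by
  have hconn := hG.connected
  have hac := hG.isAcyclic
  rcases lt_or_ge 0 r with hr | hr
  · have hiff : ∀ xs, IsStable G r xs ↔ IsFullDissensus G r xs := fun xs ↦
      ⟨fun h ↦ h.isFullDissensus hac hr, fun h ↦ h.isStable hconn hr⟩
    refine ⟨?_, ?_, ?_, fun _ xs ↦ ⟨hiff xs, fun h ↦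
      ⟨xs, h.1.mem_basin_self, ((hiff xs).mp h).mem_subcritical hr⟩⟩, ?_⟩
    · refine Set.Subset.antisymm (fun x hx ↦ ?_)
        (Set.iUnion₂_subset fun _ _ ↦ Set.inter_subset_right)
      obtain ⟨xs, hxs, hpos⟩ := exists_isFullDissensus_diff_mul_pos hac hr
        fun i j hij ↦ diff_ne_zero_of_mem_subcritical hx hij
      exact Set.mem_biUnion ((hiff xs).mpr hxs)
        ⟨mem_basin_of_isFullDissensus hconn hr hx hxs hpos, hx⟩
    · intro xs hxs ys hys hne
      refine Set.disjoint_left.mpr fun x hx hy ↦ hne ?_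
      exact ((hiff xs).mp hxs).eq_of_forall_diff_mul_pos hconn hr.le ((hiff ys).mp hys)
        (fun i j ↦ diff_mul_pos_of_mem_basin hx.1 hx.2)
        (fun i j ↦ diff_mul_pos_of_mem_basin hy.1 hy.2)
    · intro xs hst hns
      refine Set.eq_empty_of_forall_notMem fun x hx ↦ hns ((hiff xs).mpr ?_)
      exact hst.isFullDissensus_of_mem_subcritical hac hr.le
        (mem_subcritical_of_mem_basin hx.1 hx.2)
    · intro xs hst
      refine Set.Subset.antisymm
        (fun x hx ↦ ⟨fun i j ↦ diff_mul_pos_of_mem_basin hx.1 hx.2, hx.2⟩) fun x hx ↦ ⟨?_, hx.2⟩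
      refine mem_basin_of_isFullDissensus hconn hr hx.2 ?_ hx.1
      -- The strict sign condition rules out zero differences of `xs`, so stationarity forces full
      -- dissensus.
      exact (isFullDissensus_iff hr.le).mpr fun i j hij ↦
        hst.diff_sq_eq hac hij (right_ne_zero_of_mul (hx.1 i j hij).ne')
  · rcases (subcritical G r).eq_empty_or_nonempty with he | ⟨x₀, hx₀⟩
    · simp only [he, Set.inter_empty, Set.iUnion_empty, not_lt_of_ge hr, false_imp_iff,
        implies_true, and_true, true_and]
      exact fun _ _ _ _ _ ↦ disjoint_bot_left
    · have hna := not_adj_of_mem_subcritical hr hx₀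
      have hss : ∀ x y : StateSpace N, x = y := fun x y ↦
        ext_of_adj hconn fun i j hij ↦ (hna i j hij).elim
      have hst : ∀ x, IsStationaryState G r x := fun x i ↦
        Finset.sum_eq_zero fun j hj ↦ (hna i j (by simpa using hj)).elim
      have hstable : ∀ x, IsStable G r x := fun x ↦ ⟨hst x, fun w hw ↦ (hw (hss _ _)).elim⟩
      have hb : ∀ x y, x ∈ basin G r y := fun x y ↦ hss y x ▸ (hst y).mem_basin_self
      refine ⟨?_, fun xs _ ys _ hne ↦ (hne (hss xs ys)).elim, fun xs _ h ↦ (h (hstable xs)).elim,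
        fun h ↦ (hr.not_gt h).elim, fun xs _ ↦ ?_⟩
      · ext x
        simp only [Set.mem_iUnion, Set.mem_inter_iff]
        exact ⟨fun hx ↦ ⟨x, hstable x, hb x x, hx⟩, fun ⟨_, _, _, hx⟩ ↦ hx⟩
      · ext x
        exact ⟨fun hx ↦ ⟨fun i j hij ↦ (hna i j hij).elim, hx.2⟩, fun hx ↦ ⟨hb x xs, hx.2⟩⟩
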